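/- Let $(\Omega,P)$ be a probability space and let $\sigma:\Omega\to\Omega$ be an invertible bimeasurable $P$-preserving map (for instance the two-sided Bernoulli shift). Let $(\Lambda,m_0)$ be a finite measure space, let $R:\Omega\times\Lambda\to\{1,2,\dots\}$ be a measurable return time, and let $(\omega,x)\mapsto G_\omega(x)\in\Lambda$ be a measurable return map. The random tower consists of the sets $\Delta_\omega=\{(x,k)\in\Lambda\times\mathbb Z_{\ge0}: k<R_{\sigma^{-k}\omega}(x)\}$, equipped with the measure $m$ that is a copy of $m_0$ on each level. The tower maps $F_\omega:\Delta_\omega\to\Delta_{\sigma\omega}$ are given by $F_\omega(x,k)=(x,k+1)$ if $k+1<R_{\sigma^{-k}\omega}(x)$ and $F_\omega(x,k)=(G_{\sigma^{-k}\omega}(x),0)$ otherwise. Put $F^\ell_\omega=F_{\sigma^{\ell-1}\omega}\circ\cdots\circ F_\omega$, $\Delta_{\omega,0}=\Delta_\omega\cap\{k=0\}$, $F(\omega,z)=(\sigma\omega,F_\omega(z))$ and $$V^\ell_\omega=m\big(\Delta_{\omega,0}\cap F_\omega^{-\ell}\Delta_{\sigma^\ell\omega,0}\big).$$ (a) The function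 $\omega\mapsto V^\ell_\omega$ is $P$-integrable. If $\int_\Omega V^\ell_\omega\,dP>0$ for some $\ell\ge0$, then for all integers $s\ge0$ and all real $\upsilon>0$ one has $\int_\Omega \exp[-\upsilon V^\ell_{\sigma^s\omega}]\,dP(\omega)<1$. (b) Let $(\mu_\omega)_{\omega\in\Omega}$ be a measurable family of probability measures such that, for almost every $\omega$, $\mu_\omega=h_\omega m$ on $\Delta_\omega$ with $h_\omega\ge0$ measurable, and $(F_\omega)_*\mu_\omega=\mu_{\sigma\omega}$. Suppose that there is a constant $K$ with $h_\omega\le K$ $m$-a.e. on $\Delta_\omega$ for almost every $\omega$. Let $\mu_\epsilon$ be the probability measure $d\mu_\epsilon(\omega,z)=d\mu_\omega(z)\,dP(\omega)$, and suppose that $F$ is mixing for $\mu_\epsilon$. Write $\mu_\epsilon(\Lambda)=\int_\Omega\mu_\omega(\Delta_{\omega,0})\,dP$ and $\hat V^\ell_\omega=\mu_\omega(\Delta_{\omega,0}\cap F_\omega^{-\ell}\Delta_{\sigma^\ell\omega,0})$. Then: 1. $\hat V^\ell$ is $P$-integrable for every $\ell$, and $\lim_{\ell\to\infty}\int_\Omega\hat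 V^\ell_\omega\,dP(\omega)=\mu_\epsilon(\Lambda)^2>0$. 2. $K>0$, and for almost every $\omega$ and all $\ell\ge0$, $V^\ell_\omega\ge K^{-1}\hat V^\ell_\omega$. 3. There are $\ell_0\ge0$ and $c>0$ such that $\int_\Omega V^\ell_\omega\,dP(\omega)\ge c$ for all $\ell\ge\ell_0$. Moreover, with the same $\ell_0$, for every $\upsilon>0$ there is $\rho<1$ such that for all integers $\tau_0\ge0$ and $\tau_1\ge\tau_0+\ell_0$, $$\int_\Omega\exp\big[-\upsilon V^{\tau_1-\tau_0}_{\sigma^{\tau_0}\omega}\big]\,dP(\omega)\le\rho.$$ -/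

import Mathlib

open MeasureTheory ProbabilityTheory Filter Topology

/-- A random tower over the driving system `(Ω, P, σ)` with base `(Λ, m₀)`.  The base map of the
driving system is invertible and preserves `P`.  `R ω x` is the return time of the base point `x`
for the noise realization `ω`, and `ret ω x` is the point of the base to which `x` returns after
`R ω x` steps. -/
structure RandomTower (Ω Λ : Type*) [MeasurableSpace Ω] [MeasurableSpace Λ]
    (P : Measure Ω) where
  σ : Ω ≃ᵐ Ω
  σ_preserves : MeasurePreserving σ P P
  R : Ω → Λ → ℕ
  R_pos : ∀ ω x, 1 ≤ R ω x
  R_measurable : Measurable (Function.uncurry R)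
  ret : Ω → Λ → Λ
  ret_measurable : Measurable (Function.uncurry ret)

namespace RandomTower

variable {Ω Λ : Type*} [MeasurableSpace Ω] [MeasurableSpace Λ] {P : Measure Ω}

/-- The tower over `ω`: `Δ_ω = {(x, ℓ) : 0 ≤ ℓ ≤ R_{σ^{-ℓ} ω}(x) - 1}`. -/
def tower (T : RandomTower Ω Λ P) (ω : Ω) : Set (Λ × ℕ) :=
  {z | z.2 < T.R (T.σ.symm^[z.2] ω) z.1}

/-- The ground floor `Δ_{ω,0}` of the tower over `ω`. -/
def floor (T : RandomTower Ω Λ P) (ω : Ω) : Set (Λ × ℕ) :=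
  {z | z ∈ T.tower ω ∧ z.2 = 0}

/-- The tower map `F_ω : Δ_ω → Δ_{σω}`: go up one level as long as the return time is not
reached, and then return to the ground floor.  (The formula makes sense on all of `Λ × ℕ`; only
its restriction to `Δ_ω` matters.) -/
def map (T : RandomTower Ω Λ P) (ω : Ω) (z : Λ × ℕ) : Λ × ℕ :=
  if z.2 + 1 < T.R (T.σ.symm^[z.2] ω) z.1 then (z.1, z.2 + 1)
  else (T.ret (T.σ.symm^[z.2] ω) z.1, 0)

theorem mapsTo_map (T : RandomTower Ω Λ P) (ω : Ω) :
    Set.MapsTo (T.map ω) (T.tower ω) (T.tower (T.σ ω)) := by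
  intro z _
  unfold map
  split_ifs with h
  · simpa [tower, Function.iterate_succ_apply] using h
  · exact T.R_pos _ _

/-- The random iterates `F_ω^n = F_{σ^{n-1} ω} ∘ ⋯ ∘ F_{σ ω} ∘ F_ω`. -/
def iter (T : RandomTower Ω Λ P) : ℕ → Ω → Λ × ℕ → Λ × ℕ
  | 0, _, z => z
  | n + 1, ω, z => T.iter n (T.σ ω) (T.map ω z)

/-- The skew product `F (ω, z) = (σ ω, F_ω z)`. -/
def skew (T : RandomTower Ω Λ P) (p : Ω × (Λ × ℕ)) : Ω × (Λ × ℕ) :=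
  (T.σ p.1, T.map p.1 p.2)

/-- The union `{(ω, z) : z ∈ Δ_{ω,0}}` of all ground floors, that is, the base `Λ` seen in the
phase space of the skew product. -/
def base (T : RandomTower Ω Λ P) : Set (Ω × (Λ × ℕ)) :=
  {p | p.2 ∈ T.floor p.1}

/-- The reference measure `m` on `Δ_ω`: on each level it is a copy of `m₀`. -/
noncomputable def refMeasure (T : RandomTower Ω Λ P) (m₀ : Measure Λ) (ω : Ω) :
    Measure (Λ × ℕ) :=
  (m₀.prod Measure.count).restrict (T.tower ω)

/-- The set `Δ_{ω,0} ∩ F_ω^{-ℓ} Δ_{σ^ℓ ω,0}`. -/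
def returnSet (T : RandomTower Ω Λ P) (ℓ : ℕ) (ω : Ω) : Set (Λ × ℕ) :=
  T.floor ω ∩ T.iter ℓ ω ⁻¹' T.floor (T.σ^[ℓ] ω)

/-- `V_ω^ℓ = m (Δ_{ω,0} ∩ F_ω^{-ℓ} Δ_{σ^ℓ ω,0})`. -/
noncomputable def V (T : RandomTower Ω Λ P) (m₀ : Measure Λ) (ℓ : ℕ) (ω : Ω) : ℝ :=
  (T.refMeasure m₀ ω).real (T.returnSet ℓ ω)

/-- `V̂_ω^ℓ = μ_ω (Δ_{ω,0} ∩ F_ω^{-ℓ} Δ_{σ^ℓ ω,0})`. -/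
noncomputable def Vhat (T : RandomTower Ω Λ P) (μ : Kernel Ω (Λ × ℕ)) (ℓ : ℕ) (ω : Ω) : ℝ :=
  (μ ω).real (T.returnSet ℓ ω)

/-- `{μ_ω}` is an absolutely continuous sample stationary probability measure with densities
`h_ω`: `μ_ω = h_ω m` on `Δ_ω`, and `(F_ω)_* μ_ω = μ_{σω}`, for almost every `ω`. -/
structure IsSampleStationary (T : RandomTower Ω Λ P) (m₀ : Measure Λ)
    (μ : Kernel Ω (Λ × ℕ)) (h : Ω → Λ × ℕ → ℝ) : Prop where
  markov : IsMarkovKernel μ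
  density_measurable : ∀ᵐ ω ∂P, Measurable (h ω)
  density_nonneg : ∀ᵐ ω ∂P, ∀ z, 0 ≤ h ω z
  density : ∀ᵐ ω ∂P,
    μ ω = (T.refMeasure m₀ ω).withDensity (fun z => ENNReal.ofReal (h ω z))
  stationary : ∀ᵐ ω ∂P, (μ ω).map (T.map ω) = μ (T.σ ω)

end RandomTower

/-- A measure preserving map `F` of a probability space is mixing. -/
structure IsMixing {S : Type*} [MeasurableSpace S] (F : S → S) (ν : Measure S) : Prop where
  measurePreserving : MeasurePreserving F ν ν
  tendsto : ∀ A B : Set S, MeasurableSet A → MeasurableSet B →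
    Tendsto (fun n : ℕ => ν.real (A ∩ F^[n] ⁻¹' B)) atTop (𝓝 (ν.real A * ν.real B))

namespace RandomTower

variable {Ω Λ : Type*} [MeasurableSpace Ω] [MeasurableSpace Λ] {P : Measure Ω}

/-! Since `V` takes values in `[0, m₀ Λ]`, the convex function `exp (-υ V)` has an upper bound
affine in `V`. As `σ` preserves `P`, the shift disappears on integration, and
`integral_exp_V_shift_le` bounds the Laplace integral away from `1` by a multiple of the mean of `V`
alone; this gives (a) and the uniformity in (b).

For (b), the mean of `Vhat` is the correlation of the base with itself under the skew product
(`integral_Vhat`), so mixing gives the limit. It is positive because an invariant probability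
charges the base (`measure_base_ne_zero`), and the density bound passes the lower bound on to `V`
(`ae_inv_mul_Vhat_le_V`). -/

theorem mem_floor_iff (T : RandomTower Ω Λ P) (ω : Ω) (z : Λ × ℕ) :
    z ∈ T.floor ω ↔ z.2 = 0 :=
  ⟨fun h => h.2, fun h => ⟨by
    have := T.R_pos (T.σ.symm^[z.2] ω) z.1
    simp only [tower, Set.mem_ofPred_eq]
    omega, h⟩⟩

theorem floor_eq (T : RandomTower Ω Λ P) (ω : Ω) : T.floor ω = Set.univ ×ˢ {0} := by
  ext z
  simp [mem_floor_iff]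

theorem base_eq (T : RandomTower Ω Λ P) : T.base = {p | p.2.2 = 0} := by
  ext p
  exact T.mem_floor_iff p.1 p.2

theorem measurableSet_base (T : RandomTower Ω Λ P) : MeasurableSet T.base := by
  rw [base_eq]
  exact (measurable_snd.comp measurable_snd) (measurableSet_singleton 0)

theorem measurable_symm_iterate (T : RandomTower Ω Λ P) :
    Measurable fun p : Ω × (Λ × ℕ) => T.σ.symm^[p.2.2] p.1 := by
  have h : Measurable fun q : Ω × ℕ => T.σ.symm^[q.2] q.1 :=
    measurable_from_prod_countable_left fun k => T.σ.symm.measurable.iterate k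
  exact h.comp (measurable_fst.prodMk (measurable_snd.comp measurable_snd))

theorem measurable_returnTime (T : RandomTower Ω Λ P) :
    Measurable fun p : Ω × (Λ × ℕ) => T.R (T.σ.symm^[p.2.2] p.1) p.2.1 :=
  T.R_measurable.comp
    (T.measurable_symm_iterate.prodMk (measurable_fst.comp measurable_snd))

theorem measurable_skew (T : RandomTower Ω Λ P) : Measurable T.skew := by
  refine (T.σ.measurable.comp measurable_fst).prodMk ?_
  refine Measurable.ite ?_ ?_ ?_
  · exact measurableSet_lt ((measurable_snd.comp measurable_snd).add_const 1)
      T.measurable_returnTime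
  · exact (measurable_fst.comp measurable_snd).prodMk
      ((measurable_snd.comp measurable_snd).add_const 1)
  · exact (T.ret_measurable.comp
      (T.measurable_symm_iterate.prodMk (measurable_fst.comp measurable_snd))).prodMk
      measurable_const

theorem skew_iterate (T : RandomTower Ω Λ P) (n : ℕ) (ω : Ω) (z : Λ × ℕ) :
    T.skew^[n] (ω, z) = (T.σ^[n] ω, T.iter n ω z) := by
  induction n generalizing ω z with
  | zero => rfl
  | succ n ih => exact ih (T.σ ω) (T.map ω z)

/-- Being the fibres of one measurable set, the return sets have measures that depend measurably on
`ω`. -/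
theorem returnSet_eq (T : RandomTower Ω Λ P) (ℓ : ℕ) (ω : Ω) :
    T.returnSet ℓ ω = Prod.mk ω ⁻¹' (T.base ∩ T.skew^[ℓ] ⁻¹' T.base) := by
  ext z
  simp [returnSet, base, skew_iterate]

theorem measurableSet_base_inter (T : RandomTower Ω Λ P) (ℓ : ℕ) :
    MeasurableSet (T.base ∩ T.skew^[ℓ] ⁻¹' T.base) :=
  T.measurableSet_base.inter ((T.measurable_skew.iterate ℓ) T.measurableSet_base)

theorem measurableSet_returnSet (T : RandomTower Ω Λ P) (ℓ : ℕ) (ω : Ω) :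
    MeasurableSet (T.returnSet ℓ ω) := by
  rw [returnSet_eq]
  exact measurable_prodMk_left (T.measurableSet_base_inter ℓ)

theorem refMeasure_returnSet (T : RandomTower Ω Λ P) (m₀ : Measure Λ) (ℓ : ℕ) (ω : Ω) :
    T.refMeasure m₀ ω (T.returnSet ℓ ω) = m₀.prod Measure.count (T.returnSet ℓ ω) := by
  rw [refMeasure, Measure.restrict_apply (T.measurableSet_returnSet ℓ ω),
    Set.inter_eq_left.2 fun z hz => hz.1.1]

/-- The whole tower may have infinite measure, but the return set lies in the ground floor, a single
copy of `m₀`. -/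
theorem refMeasure_returnSet_le (T : RandomTower Ω Λ P) (m₀ : Measure Λ) [IsFiniteMeasure m₀]
    (ℓ : ℕ) (ω : Ω) : T.refMeasure m₀ ω (T.returnSet ℓ ω) ≤ m₀ Set.univ := by
  rw [refMeasure_returnSet]
  calc m₀.prod Measure.count (T.returnSet ℓ ω)
      ≤ m₀.prod Measure.count ((Set.univ : Set Λ) ×ˢ ({0} : Set ℕ)) :=
        measure_mono fun z hz => T.floor_eq ω ▸ hz.1
    _ = m₀ Set.univ := by simp

theorem V_nonneg (T : RandomTower Ω Λ P) (m₀ : Measure Λ) (ℓ : ℕ) (ω : Ω) :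
    0 ≤ T.V m₀ ℓ ω := measureReal_nonneg

theorem V_le (T : RandomTower Ω Λ P) (m₀ : Measure Λ) [IsFiniteMeasure m₀] (ℓ : ℕ) (ω : Ω) :
    T.V m₀ ℓ ω ≤ m₀.real Set.univ :=
  ENNReal.toReal_mono (measure_ne_top _ _) (T.refMeasure_returnSet_le m₀ ℓ ω)

theorem measurable_V (T : RandomTower Ω Λ P) (m₀ : Measure Λ) [IsFiniteMeasure m₀] (ℓ : ℕ) :
    Measurable (T.V m₀ ℓ) := by
  have h := measurable_measure_prodMk_left (ν := m₀.prod (Measure.count : Measure ℕ))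
    (T.measurableSet_base_inter ℓ)
  convert! h.ennreal_toReal using 1
  funext ω
  rw [V, Measure.real, refMeasure_returnSet, returnSet_eq]

theorem integrable_V [IsProbabilityMeasure P] (T : RandomTower Ω Λ P) (m₀ : Measure Λ)
    [IsFiniteMeasure m₀] (ℓ : ℕ) : Integrable (T.V m₀ ℓ) P :=
  Integrable.of_bound (T.measurable_V m₀ ℓ).aestronglyMeasurable (m₀.real Set.univ)
    (.of_forall fun ω => by
      rw [Real.norm_of_nonneg (T.V_nonneg m₀ ℓ ω)]
      exact T.V_le m₀ ℓ ω)

theorem integrable_exp_V [IsProbabilityMeasure P] (T : RandomTower Ω Λ P) (m₀ : Measure Λ)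
    [IsFiniteMeasure m₀] (ℓ : ℕ) {υ : ℝ} (hυ : 0 < υ) :
    Integrable (fun ω => Real.exp (-(υ * T.V m₀ ℓ ω))) P :=
  Integrable.of_bound
    (((T.measurable_V m₀ ℓ).const_mul υ).neg.exp).aestronglyMeasurable 1
    (.of_forall fun ω => by
      rw [Real.norm_of_nonneg (Real.exp_nonneg _), Real.exp_le_one_iff, neg_nonpos]
      exact mul_nonneg hυ.le (T.V_nonneg m₀ ℓ ω))

theorem measurePreserving_iterate (T : RandomTower Ω Λ P) (s : ℕ) :
    MeasurePreserving (T.σ^[s]) P P := T.σ_preserves.iterate s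

theorem integrable_exp_V_shift [IsProbabilityMeasure P] (T : RandomTower Ω Λ P)
    (m₀ : Measure Λ) [IsFiniteMeasure m₀] (ℓ : ℕ) {υ : ℝ} (hυ : 0 < υ) (s : ℕ) :
    Integrable (fun ω => Real.exp (-(υ * T.V m₀ ℓ (T.σ^[s] ω)))) P :=
  (T.measurePreserving_iterate s).integrable_comp_of_integrable (T.integrable_exp_V m₀ ℓ hυ)

theorem integral_exp_V_shift [IsProbabilityMeasure P] (T : RandomTower Ω Λ P)
    (m₀ : Measure Λ) [IsFiniteMeasure m₀] (ℓ : ℕ) {υ : ℝ} (hυ : 0 < υ) (s : ℕ) :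
    ∫ ω, Real.exp (-(υ * T.V m₀ ℓ (T.σ^[s] ω))) ∂P =
      ∫ ω, Real.exp (-(υ * T.V m₀ ℓ ω)) ∂P := by
  have hmp := T.measurePreserving_iterate s
  have h := integral_map (μ := P) hmp.measurable.aemeasurable
    (f := fun ω => Real.exp (-(υ * T.V m₀ ℓ ω))) (by
      rw [hmp.map_eq]
      exact (T.integrable_exp_V m₀ ℓ hυ).aestronglyMeasurable)
  exact h.symm.trans (congrArg (fun ρ => ∫ ω, Real.exp (-(υ * T.V m₀ ℓ ω)) ∂ρ) hmp.map_eq)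

/-- From `1 + t ≤ exp t`. The bound is affine in `t`, so integrating it leaves only the mean. -/
theorem exp_neg_le_one_sub_div {t M : ℝ} (ht : 0 ≤ t) (htM : t ≤ M) :
    Real.exp (-t) ≤ 1 - t / (1 + M) := by
  have h1 : Real.exp (-t) ≤ 1 / (1 + t) := by
    rw [Real.exp_neg, ← one_div]
    exact one_div_le_one_div_of_le (by positivity) (by linarith [Real.add_one_le_exp t])
  have h2 : 1 / (1 + t) = 1 - t / (1 + t) := by field_simp; ring
  have h3 : t / (1 + M) ≤ t / (1 + t) := by gcongr
  linarith

/-- The Laplace transform of `V^ℓ` is bounded away from `1` in terms of the mean of `V^ℓ`. -/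
theorem integral_exp_V_shift_le [IsProbabilityMeasure P] (T : RandomTower Ω Λ P)
    (m₀ : Measure Λ) [IsFiniteMeasure m₀] (ℓ : ℕ) {υ : ℝ} (hυ : 0 < υ) (s : ℕ) :
    ∫ ω, Real.exp (-(υ * T.V m₀ ℓ (T.σ^[s] ω))) ∂P ≤
      1 - υ / (1 + υ * m₀.real Set.univ) * ∫ ω, T.V m₀ ℓ ω ∂P := by
  rw [T.integral_exp_V_shift m₀ ℓ hυ s]
  have hi := (T.integrable_V m₀ ℓ).const_mul (υ / (1 + υ * m₀.real Set.univ))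
  calc ∫ ω, Real.exp (-(υ * T.V m₀ ℓ ω)) ∂P
      ≤ ∫ ω, (1 - υ / (1 + υ * m₀.real Set.univ) * T.V m₀ ℓ ω) ∂P := by
        refine integral_mono (T.integrable_exp_V m₀ ℓ hυ) ((integrable_const 1).sub hi) fun ω => ?_
        have h := exp_neg_le_one_sub_div (mul_nonneg hυ.le (T.V_nonneg m₀ ℓ ω))
          (mul_le_mul_of_nonneg_left (T.V_le m₀ ℓ ω) hυ.le)
        rwa [mul_div_right_comm] at h
    _ = _ := by
        rw [integral_sub (integrable_const 1) hi, integral_const_mul]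
        simp

theorem integrable_Vhat [IsProbabilityMeasure P] (T : RandomTower Ω Λ P)
    (μ : Kernel Ω (Λ × ℕ)) [IsMarkovKernel μ] (ℓ : ℕ) : Integrable (T.Vhat μ ℓ) P := by
  refine Integrable.of_bound (Measurable.aestronglyMeasurable ?_) 1 (.of_forall fun ω => ?_)
  · convert! (Kernel.measurable_kernel_prodMk_left (κ := μ)
      (T.measurableSet_base_inter ℓ)).ennreal_toReal using 1
    funext ω
    rw [Vhat, Measure.real, returnSet_eq]
  · rw [Vhat, Real.norm_of_nonneg measureReal_nonneg]
    exact measureReal_le_one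

theorem integral_Vhat [IsProbabilityMeasure P] (T : RandomTower Ω Λ P)
    (μ : Kernel Ω (Λ × ℕ)) [IsMarkovKernel μ] (ℓ : ℕ) :
    ∫ ω, T.Vhat μ ℓ ω ∂P = (P ⊗ₘ μ).real (T.base ∩ T.skew^[ℓ] ⁻¹' T.base) := by
  rw [Measure.real, Measure.compProd_apply (T.measurableSet_base_inter ℓ), ← integral_toReal
    (Kernel.measurable_kernel_prodMk_left (κ := μ) (T.measurableSet_base_inter ℓ)).aemeasurable
    (.of_forall fun ω => measure_lt_top _ _)]
  simp only [Vhat, Measure.real, returnSet_eq]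

/-- An invariant probability measure of the skew product charges the base, because every level
of the tower is only reached through the levels below it. -/
theorem measure_base_ne_zero (T : RandomTower Ω Λ P) (ν : Measure (Ω × (Λ × ℕ)))
    [IsProbabilityMeasure ν] (hν : MeasurePreserving T.skew ν ν) : ν T.base ≠ 0 := by
  intro h0
  have hlevel : ∀ k : ℕ, ν {p | p.2.2 = k} = 0 := by
    intro k
    induction k with
    | zero => rwa [base_eq] at h0
    | succ k ih =>
      have hm : MeasurableSet {p : Ω × (Λ × ℕ) | p.2.2 = k + 1} :=
        (measurable_snd.comp measurable_snd) (measurableSet_singleton (k + 1))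
      rw [← hν.measure_preimage hm.nullMeasurableSet]
      refine measure_mono_null (fun p hp => ?_) ih
      simp only [Set.mem_preimage, Set.mem_ofPred_eq, skew, map] at hp ⊢
      -- A return lands on level `0`, so level `k + 1` is entered only by climbing from level `k`.
      split_ifs at hp with h
      simpa using hp
  have huniv : (Set.univ : Set (Ω × (Λ × ℕ))) = ⋃ k : ℕ, {p | p.2.2 = k} := by
    ext p
    simp
  have h1 : ν Set.univ = 0 := by
    rw [huniv]
    exact measure_iUnion_null hlevel
  simp at h1

namespace IsSampleStationary

variable {T : RandomTower Ω Λ P} {m₀ : Measure Λ} {μ : Kernel Ω (Λ × ℕ)} {h : Ω → Λ × ℕ → ℝ}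
  {K : ℝ}

/-- Domination as measures gives one exceptional null set of `ω` that serves all `ℓ`. -/
theorem ae_le_smul (hs : T.IsSampleStationary m₀ μ h)
    (hK : ∀ᵐ ω ∂P, ∀ᵐ z ∂(T.refMeasure m₀ ω), h ω z ≤ K) :
    ∀ᵐ ω ∂P, μ ω ≤ ENNReal.ofReal K • T.refMeasure m₀ ω := by
  filter_upwards [hs.density, hK] with ω hd hb
  rw [hd, ← withDensity_const]
  exact withDensity_mono (hb.mono fun z hz => ENNReal.ofReal_le_ofReal hz)

theorem bound_pos [IsProbabilityMeasure P] (hs : T.IsSampleStationary m₀ μ h)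
    (hK : ∀ᵐ ω ∂P, ∀ᵐ z ∂(T.refMeasure m₀ ω), h ω z ≤ K) : 0 < K := by
  have := hs.markov
  obtain ⟨ω, hω⟩ := (hs.ae_le_smul hK).exists
  by_contra! hneg
  have h1 := hω Set.univ
  -- For `K ≤ 0` the dominating measure is zero, whereas `μ ω` has mass `1`.
  simp [ENNReal.ofReal_of_nonpos hneg] at h1

theorem ae_inv_mul_Vhat_le_V [IsProbabilityMeasure P] [IsFiniteMeasure m₀]
    (hs : T.IsSampleStationary m₀ μ h)
    (hK : ∀ᵐ ω ∂P, ∀ᵐ z ∂(T.refMeasure m₀ ω), h ω z ≤ K) :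
    ∀ᵐ ω ∂P, ∀ ℓ : ℕ, K⁻¹ * T.Vhat μ ℓ ω ≤ T.V m₀ ℓ ω := by
  have hpos := hs.bound_pos hK
  filter_upwards [hs.ae_le_smul hK] with ω hω ℓ
  rw [inv_mul_le_iff₀ hpos]
  have hfin : T.refMeasure m₀ ω (T.returnSet ℓ ω) ≠ ⊤ :=
    ((T.refMeasure_returnSet_le m₀ ℓ ω).trans_lt (measure_lt_top _ _)).ne
  have h1 := ENNReal.toReal_mono (ENNReal.mul_ne_top ENNReal.ofReal_ne_top hfin)
    (hω (T.returnSet ℓ ω))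
  rwa [ENNReal.toReal_mul, ENNReal.toReal_ofReal hpos.le] at h1

end IsSampleStationary

end RandomTower

theorem lemma5p1 {Ω Λ : Type*} [MeasurableSpace Ω] [MeasurableSpace Λ]
    (P : Measure Ω) [IsProbabilityMeasure P] (m₀ : Measure Λ) [IsFiniteMeasure m₀]
    (T : RandomTower Ω Λ P) :
    -- the integrals of `V^ℓ` and of the exponentials are genuine
    (∀ ℓ : ℕ, Integrable (T.V m₀ ℓ) P ∧ ∀ (υ : ℝ) (s : ℕ), 0 < υ →
        Integrable (fun ω => Real.exp (-(υ * T.V m₀ ℓ (T.σ^[s] ω)))) P) ∧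
    -- positivity of the integral of `V^ℓ` suffices
    (∀ ℓ : ℕ, 0 < ∫ ω, T.V m₀ ℓ ω ∂P → ∀ (υ : ℝ) (s : ℕ), 0 < υ →
      ∫ ω, Real.exp (-(υ * T.V m₀ ℓ (T.σ^[s] ω))) ∂P < 1) ∧
    -- let the densities `h_ω` of the sample measures `μ_ω` be bounded from above by `K`, uniformly
    -- in `ω`, and let the skew product be mixing for the measure with fibre measures `μ_ω`
    ∀ (μ : Kernel Ω (Λ × ℕ)) (h : Ω → Λ × ℕ → ℝ) (K : ℝ),
      T.IsSampleStationary m₀ μ h →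
      (∀ᵐ ω ∂P, ∀ᵐ z ∂(T.refMeasure m₀ ω), h ω z ≤ K) →
      IsMixing T.skew (P ⊗ₘ μ) →
      -- the limit of the integrals of `V̂^ℓ`, and its positivity
      (∀ ℓ : ℕ, Integrable (T.Vhat μ ℓ) P) ∧
      Tendsto (fun ℓ : ℕ => ∫ ω, T.Vhat μ ℓ ω ∂P) atTop (𝓝 ((P ⊗ₘ μ).real T.base ^ 2)) ∧
      0 < (P ⊗ₘ μ).real T.base ∧
      -- transfer to `V^ℓ`
      (0 < K ∧ ∀ᵐ ω ∂P, ∀ ℓ : ℕ, K⁻¹ * T.Vhat μ ℓ ω ≤ T.V m₀ ℓ ω) ∧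
      -- the resulting bounds, uniform for large `ℓ = τ₁ - τ₀`
      (∃ ℓ₀ : ℕ, (∃ c > 0, ∀ ℓ ≥ ℓ₀, c ≤ ∫ ω, T.V m₀ ℓ ω ∂P) ∧
        ∀ υ : ℝ, 0 < υ → ∃ ρ < 1, ∀ τ₀ τ₁ : ℕ, τ₀ + ℓ₀ ≤ τ₁ →
          ∫ ω, Real.exp (-(υ * T.V m₀ (τ₁ - τ₀) (T.σ^[τ₀] ω))) ∂P ≤ ρ) := by
  refine ⟨fun ℓ => ⟨T.integrable_V m₀ ℓ, fun υ s hυ => T.integrable_exp_V_shift m₀ ℓ hυ s⟩,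
    fun ℓ hℓ υ s hυ => ?_, fun μ h K hs hK hmix => ?_⟩
  · have hpos : 0 < υ / (1 + υ * m₀.real Set.univ) * ∫ ω, T.V m₀ ℓ ω ∂P := by positivity
    linarith [T.integral_exp_V_shift_le m₀ ℓ hυ s]
  have := hs.markov
  have hlim : Tendsto (fun ℓ : ℕ => ∫ ω, T.Vhat μ ℓ ω ∂P) atTop
      (𝓝 ((P ⊗ₘ μ).real T.base ^ 2)) := by
    simp only [T.integral_Vhat μ, sq]
    exact hmix.tendsto _ _ T.measurableSet_base T.measurableSet_base
  have hbase : 0 < (P ⊗ₘ μ).real T.base :=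
    ENNReal.toReal_pos (T.measure_base_ne_zero _ hmix.measurePreserving) (measure_ne_top _ _)
  have hKpos := hs.bound_pos hK
  have hV := hs.ae_inv_mul_Vhat_le_V hK
  refine ⟨T.integrable_Vhat μ, hlim, hbase, ⟨hKpos, hV⟩, ?_⟩
  -- Half of the positive limit serves as threshold, so `ℓ₀` is fixed before `υ` enters.
  obtain ⟨ℓ₀, hℓ₀⟩ := eventually_atTop.1
    (hlim.eventually (eventually_ge_nhds (half_lt_self (pow_pos hbase 2))))
  have hc : 0 < K⁻¹ * ((P ⊗ₘ μ).real T.base ^ 2 / 2) := by positivity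
  have hlower : ∀ ℓ ≥ ℓ₀, K⁻¹ * ((P ⊗ₘ μ).real T.base ^ 2 / 2) ≤ ∫ ω, T.V m₀ ℓ ω ∂P := by
    intro ℓ hℓ
    calc K⁻¹ * ((P ⊗ₘ μ).real T.base ^ 2 / 2)
        ≤ K⁻¹ * ∫ ω, T.Vhat μ ℓ ω ∂P :=
          mul_le_mul_of_nonneg_left (hℓ₀ ℓ hℓ) (inv_nonneg.2 hKpos.le)
      _ = ∫ ω, K⁻¹ * T.Vhat μ ℓ ω ∂P := (integral_const_mul _ _).symm
      _ ≤ ∫ ω, T.V m₀ ℓ ω ∂P :=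
          integral_mono_ae ((T.integrable_Vhat μ ℓ).const_mul _) (T.integrable_V m₀ ℓ)
            (hV.mono fun ω hω => hω ℓ)
  refine ⟨ℓ₀, ⟨_, hc, hlower⟩, fun υ hυ => ?_⟩
  have hcoef : 0 < υ / (1 + υ * m₀.real Set.univ) := by positivity
  -- This `ρ` is the Laplace bound with the mean of `V` replaced by its uniform lower bound.
  refine ⟨1 - υ / (1 + υ * m₀.real Set.univ) * (K⁻¹ * ((P ⊗ₘ μ).real T.base ^ 2 / 2)),
    by linarith [mul_pos hcoef hc], fun τ₀ τ₁ hτ => ?_⟩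
  refine (T.integral_exp_V_shift_le m₀ (τ₁ - τ₀) hυ τ₀).trans ?_
  exact sub_le_sub_left
    (mul_le_mul_of_nonneg_left (hlower (τ₁ - τ₀) (by omega)) hcoef.le) 1
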